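/- **Theorem (Gehrke–Petrişan–Reggio).** Let $\mathbf{Stone}$ be the category of Stone spaces (compact Hausdorff totally disconnected spaces) and continuous maps, $\mathbf{JSL}$ the category of join-semilattices with bottom and maps preserving finite joins, and $2=\{0,1\}$, regarded as a discrete space and as a join-semilattice. For a Stone space $X$, let $\mathbb{V}X$ be the set of all closed subsets of $X$ with the hit-or-miss topology, whose subbasic open sets are $\Diamond U=\{C : C\cap U\neq\emptyset\}$ and $\Box U=\{C : C\cap U=\emptyset\}$ for $U\subseteq X$ clopen. The Vietoris monad $\mathbb{V}$ on $\mathbf{Stone}$ sends $X$ to $\mathbb{V}X$ and a continuous map to its direct-image map; its unit is $x\mapsto\{x\}$ and its multiplication is union. 1. $\mathbb{V}$ is isomorphic, as a monad, to the monad induced by the dual adjunction $\mathbf{Stone}(-,2)\dashv\mathbf{JSL}(-,2)\colon\mathbf{JSL}^{\mathrm{op}}\to\mathbf{Stone}$, where joins in $\mathbf{Stone}(X,2)$ are pointwise and $\mathbf{JSL}(J,2)$ is a subspace of the product space $2^{J}$. In particular $\mathbb{V}X\cong\mathbf{JSL}(\mathbf{Stone}(X,2),2)$; the isomorphism sends a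 closed set $C$ to the morphism $\varphi_C$ with $\varphi_C(g)=0$ if and only if $C\cap g^{-1}(1)=\emptyset$, i.e. to the ideal of all clopen sets disjoint from $C$. 2. Let $\mathcal{P}_f$ be the finite powerset monad on $\mathbf{Set}$, $\mathbf{Kl}_f(\mathcal{P}_f)$ the full subcategory of its Kleisli category on the finite sets, and $U_{\mathcal{P}_f}\colon\mathbf{Kl}_f(\mathcal{P}_f)\to\mathbf{Stone}$ the functor that sends a finite set $X$ to the discrete space $\mathcal{P}_fX\cong 2^X$ and a Kleisli morphism $f\colon X\to\mathcal{P}_fY$ to $f^{\#}\colon\mathcal{P}_fX\to\mathcal{P}_fY$, $S\mapsto\bigcup_{x\in S}f(x)$. Then the right Kan extension of $U_{\mathcal{P}_f}$ along itself exists and is pointwise, and the codensity monad of $U_{\mathcal{P}_f}$ is isomorphic, as a monad, to $\mathbb{V}$. -/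

import Mathlib

open CategoryTheory

universe u v₁ v₂ u₁ u₂

noncomputable section

namespace VietorisCodensity

/-! ## Codensity monads -/

section Codensity

variable {A : Type u₁} {C : Type u₂} [Category.{v₁} A] [Category.{v₂} C]

/-- The functor `Ran_F F` underlying the codensity monad of `F`. -/
abbrev ranSelf (F : A ⥤ C) [F.HasRightKanExtension F] : C ⥤ C :=
  F.rightKanExtension F

/-- The counit `φ : (Ran_F F) F ⟶ F`. -/
abbrev ranSelfCounit (F : A ⥤ C) [F.HasRightKanExtension F] : F ⋙ ranSelf F ⟶ F :=
  F.rightKanExtensionCounit F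

/-- The unit of the codensity monad corresponds to `id : F ⟶ F`. -/
def codensityUnit (F : A ⥤ C) [F.HasRightKanExtension F] : 𝟭 C ⟶ ranSelf F :=
  (ranSelf F).liftOfIsRightKanExtension (ranSelfCounit F) (𝟭 C) F.rightUnitor.hom

/-- The multiplication of the codensity monad corresponds to
`(Ran_F F) (Ran_F F) F ⟶ (Ran_F F) F ⟶ F`, the composite of `(Ran_F F) φ` and `φ`. -/
def codensityMul (F : A ⥤ C) [F.HasRightKanExtension F] :
    ranSelf F ⋙ ranSelf F ⟶ ranSelf F :=
  (ranSelf F).liftOfIsRightKanExtension (ranSelfCounit F) (ranSelf F ⋙ ranSelf F)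
    ((F.associator (ranSelf F) (ranSelf F)).inv ≫
      Functor.whiskerRight (ranSelfCounit F) (ranSelf F) ≫ ranSelfCounit F)

theorem codensityUnit_fac (F : A ⥤ C) [F.HasRightKanExtension F] (a : A) :
    (codensityUnit F).app (F.obj a) ≫ (ranSelfCounit F).app a = 𝟙 (F.obj a) := by
  simp [codensityUnit]

theorem codensityMul_fac (F : A ⥤ C) [F.HasRightKanExtension F] (a : A) :
    (codensityMul F).app (F.obj a) ≫ (ranSelfCounit F).app a =
      (ranSelf F).map ((ranSelfCounit F).app a) ≫ (ranSelfCounit F).app a := by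
  simp [codensityMul]

/-- The codensity monad `(Ran_F F, η, μ)` of a functor `F` whose right Kan extension along itself
exists. -/
def codensityMonad (F : A ⥤ C) [F.HasRightKanExtension F] : Monad C where
  toFunctor := ranSelf F
  η := codensityUnit F
  μ := codensityMul F
  assoc X := by
    have h : Functor.whiskerRight (codensityMul F) (ranSelf F) ≫ codensityMul F =
        (Functor.associator _ _ _).hom ≫
          Functor.whiskerLeft (ranSelf F) (codensityMul F) ≫ codensityMul F := by
      apply (ranSelf F).hom_ext_of_isRightKanExtension (ranSelfCounit F)
      ext a
      have h1 := codensityMul_fac F a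
      simp only [Functor.whiskerLeft_app, NatTrans.comp_app, Functor.whiskerRight_app,
        Category.assoc, Functor.associator_hom_app, Functor.comp_obj, Category.id_comp, h1]
      have h2 := (codensityMul F).naturality ((ranSelfCounit F).app a)
      rw [← Functor.map_comp_assoc, h1, Functor.map_comp_assoc]
      erw [← reassoc_of% h2, h1]
    simpa using NatTrans.congr_app h X
  left_unit X := by
    have h : Functor.whiskerLeft (ranSelf F) (codensityUnit F) ≫ codensityMul F =
        (ranSelf F).rightUnitor.hom := by
      apply (ranSelf F).hom_ext_of_isRightKanExtension (ranSelfCounit F)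
      ext a
      have h1 := codensityMul_fac F a
      have h2 := codensityUnit_fac F a
      have h3 := (codensityUnit F).naturality ((ranSelfCounit F).app a)
      simp only [Functor.whiskerLeft_app, NatTrans.comp_app, Category.assoc,
        Functor.rightUnitor_hom_app, Functor.comp_obj, h1]
      erw [← reassoc_of% h3, h2]
      simp
    simpa using NatTrans.congr_app h X
  right_unit X := by
    have h : Functor.whiskerRight (codensityUnit F) (ranSelf F) ≫ codensityMul F =
        (ranSelf F).leftUnitor.hom := by
      apply (ranSelf F).hom_ext_of_isRightKanExtension (ranSelfCounit F)
      ext a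
      have h1 := codensityMul_fac F a
      have h2 := codensityUnit_fac F a
      simp only [Functor.whiskerLeft_app, NatTrans.comp_app, Functor.whiskerRight_app,
        Category.assoc, h1, Functor.leftUnitor_hom_app]
      rw [← Functor.map_comp_assoc, h2]
      simp
    simpa using NatTrans.congr_app h X

end Codensity

/-! ## The Vietoris monad on Stone spaces -/

section Hyperspace

/-- The set of closed subsets of `X`. -/
def Hyperspace (X : Type u) [TopologicalSpace X] : Type u := TopologicalSpace.Closeds X

variable {X Y : Type u} [TopologicalSpace X] [TopologicalSpace Y]

instance hyperspaceSetLike : SetLike (Hyperspace X) X := inferInstanceAs (SetLike (TopologicalSpace.Closeds X) X)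

/-- The closed sets that hit `U`. -/
def hit (U : Set X) : Set (Hyperspace X) := {C | ((C : Set X) ∩ U).Nonempty}

/-- The closed sets that miss `U`. -/
def miss (U : Set X) : Set (Hyperspace X) := {C | (C : Set X) ∩ U = ∅}

/-- The hit-or-miss topology: it has the sets `hit U` and `miss U`, for `U` clopen, as subbasis. -/
instance hitOrMiss : TopologicalSpace (Hyperspace X) :=
  TopologicalSpace.generateFrom
    ({S | ∃ U : Set X, IsClopen U ∧ S = hit U} ∪ {S | ∃ U : Set X, IsClopen U ∧ S = miss U})

theorem Hyperspace.isClosed (C : Hyperspace X) : IsClosed (C : Set X) :=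
  TopologicalSpace.Closeds.isClosed' C

theorem Hyperspace.ext {C D : Hyperspace X} (h : ∀ x, x ∈ C ↔ x ∈ D) : C = D := SetLike.ext h

theorem compl_hit (U : Set X) : (hit U)ᶜ = miss U := by
  ext C
  simp [hit, miss, Set.not_nonempty_iff_eq_empty]

theorem isOpen_hit {U : Set X} (hU : IsClopen U) : IsOpen (hit U) :=
  TopologicalSpace.isOpen_generateFrom_of_mem (Or.inl ⟨U, hU, rfl⟩)

theorem isOpen_miss {U : Set X} (hU : IsClopen U) : IsOpen (miss U) :=
  TopologicalSpace.isOpen_generateFrom_of_mem (Or.inr ⟨U, hU, rfl⟩)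

theorem isClopen_hit {U : Set X} (hU : IsClopen U) : IsClopen (hit U) :=
  ⟨⟨by rw [compl_hit]; exact isOpen_miss hU⟩, isOpen_hit hU⟩

theorem continuous_of_hit {Z : Type*} [TopologicalSpace Z] (f : Z → Hyperspace X)
    (h : ∀ U : Set X, IsClopen U → IsClopen (f ⁻¹' hit U)) : Continuous f := by
  refine continuous_generateFrom_iff.2 ?_
  rintro S (⟨U, hU, rfl⟩ | ⟨U, hU, rfl⟩)
  · exact (h U hU).isOpen
  · rw [← compl_hit, Set.preimage_compl]
    exact (h U hU).compl.isOpen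

theorem exists_finite_subcover {K : Set X} (hK : IsCompact K) {S : Set (Set X)}
    (hS : ∀ U ∈ S, IsOpen U) (hKS : K ⊆ ⋃₀ S) : ∃ T ⊆ S, T.Finite ∧ K ⊆ ⋃₀ T := by
  rw [Set.sUnion_eq_biUnion] at hKS
  obtain ⟨T, hTS, hTf, hT⟩ := hK.elim_finite_subcover_image (c := id) hS hKS
  exact ⟨T, hTS, hTf, by rwa [Set.sUnion_eq_biUnion]⟩

variable [CompactSpace X] [T2Space X] [TotallyDisconnectedSpace X]
variable [CompactSpace Y] [T2Space Y] [TotallyDisconnectedSpace Y]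

theorem exists_clopen_of_notMem (C : Hyperspace X) {x : X} (hx : x ∉ C) :
    ∃ U : Set X, IsClopen U ∧ x ∈ U ∧ C ∈ miss U := by
  obtain ⟨U, hU, hxU, hUC⟩ := compact_exists_isClopen_in_isOpen C.isClosed.isOpen_compl hx
  exact ⟨U, hU, hxU, Set.disjoint_left.2 (fun y hy hyU => hUC hyU hy) |>.inter_eq⟩

theorem exists_separating {C D : Hyperspace X} {x : X} (hC : x ∈ C) (hD : x ∉ D) :
    ∃ U : Set X, IsClopen U ∧ C ∈ hit U ∧ D ∈ miss U := by
  obtain ⟨U, hU, hxU, hUC⟩ := exists_clopen_of_notMem D hD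
  exact ⟨U, hU, ⟨x, hC, hxU⟩, hUC⟩

instance hyperspaceTotallySeparated : TotallySeparatedSpace (Hyperspace X) := by
  refine ⟨fun C _ D _ hne => ?_⟩
  have : ∃ x, ¬ (x ∈ C ↔ x ∈ D) := by
    by_contra! h
    exact hne (Hyperspace.ext h)
  obtain ⟨x, hx⟩ := this
  by_cases hC : x ∈ C
  · obtain ⟨U, hU, h1, h2⟩ := exists_separating hC (D := D) (by tauto)
    exact ⟨hit U, miss U, isOpen_hit hU, isOpen_miss hU, h1, h2,
      by rw [← compl_hit, Set.union_compl_self],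
      by rw [← compl_hit]; exact disjoint_compl_right⟩
  · obtain ⟨U, hU, h1, h2⟩ := exists_separating (C := D) (D := C) (x := x) (by tauto) hC
    exact ⟨miss U, hit U, isOpen_miss hU, isOpen_hit hU, h2, h1,
      by rw [← compl_hit, Set.compl_union_self],
      by rw [← compl_hit]; exact disjoint_compl_left⟩

instance hyperspaceCompact : CompactSpace (Hyperspace X) := by
  refine compactSpace_generateFrom rfl fun P hP hcov => ?_
  let O : Set (Set X) := {U | IsClopen U ∧ hit U ∈ P}
  let C : Hyperspace X :=
    (⟨(⋃₀ O)ᶜ, (isOpen_sUnion fun U hU => hU.1.isOpen).isClosed_compl⟩ :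
      TopologicalSpace.Closeds X)
  have hC : ∀ x, x ∈ C ↔ x ∉ ⋃₀ O := fun x => Iff.rfl
  obtain ⟨S, hSP, hCS⟩ : C ∈ ⋃₀ P := hcov ▸ Set.mem_univ C
  rcases hP hSP with ⟨U, hU, rfl⟩ | ⟨W, hW, rfl⟩
  · obtain ⟨x, hx, hxU⟩ := hCS
    exact absurd ⟨U, ⟨hU, hSP⟩, hxU⟩ ((hC x).1 hx)
  · have hWO : W ⊆ ⋃₀ O := fun x hxW => by
      by_contra h
      have : x ∈ (C : Set X) ∩ W := ⟨(hC x).2 h, hxW⟩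
      rw [show (C : Set X) ∩ W = ∅ from hCS] at this
      exact this
    obtain ⟨T, hTO, hTf, hWT⟩ :=
      exists_finite_subcover hW.isClosed.isCompact (fun U hU => hU.1.isOpen) hWO
    refine ⟨insert (miss W) (hit '' T), ?_, (hTf.image _).insert _, ?_⟩
    · rintro S (rfl | ⟨U, hU, rfl⟩)
      · exact hSP
      · exact (hTO hU).2
    · refine Set.eq_univ_of_forall fun D => ?_
      by_cases hD : D ∈ miss W
      · exact ⟨_, Or.inl rfl, hD⟩
      · rw [← compl_hit, Set.notMem_compl_iff] at hD
        obtain ⟨x, hxD, hxW⟩ := hD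
        obtain ⟨U, hU, hxU⟩ := hWT hxW
        exact ⟨hit U, Or.inr ⟨U, hU, rfl⟩, x, hxD, hxU⟩

/-- The direct image of a closed set. -/
def image (f : C(X, Y)) (C : Hyperspace X) : Hyperspace Y :=
  (⟨f '' C, (C.isClosed.isCompact.image f.continuous).isClosed⟩ : TopologicalSpace.Closeds Y)

theorem mem_image (f : C(X, Y)) (C : Hyperspace X) (y : Y) :
    y ∈ image f C ↔ ∃ x ∈ C, f x = y := Iff.rfl

/-- The closed set `{x}`. -/
def singleton (x : X) : Hyperspace X :=
  (⟨{x}, isClosed_singleton⟩ : TopologicalSpace.Closeds X)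

theorem mem_singleton (x y : X) : y ∈ singleton x ↔ y = x := Iff.rfl

theorem isClosed_union (𝒞 : Hyperspace (Hyperspace X)) :
    IsClosed {x : X | ∃ C ∈ 𝒞, x ∈ C} := by
  rw [← isOpen_compl_iff, isOpen_iff_forall_mem_open]
  intro x hx
  let O : Set (Set X) := {U | IsClopen U ∧ x ∈ U}
  have hcov : (𝒞 : Set (Hyperspace X)) ⊆ ⋃₀ (miss '' O) := fun C hC => by
    obtain ⟨U, hU, hxU, h⟩ := exists_clopen_of_notMem C (x := x) fun h => hx ⟨C, hC, h⟩
    exact ⟨miss U, ⟨U, ⟨hU, hxU⟩, rfl⟩, h⟩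
  obtain ⟨T, hTO, hTf, hT⟩ := exists_finite_subcover 𝒞.isClosed.isCompact
    (by rintro S ⟨U, hU, rfl⟩; exact isOpen_miss hU.1) hcov
  obtain ⟨T, hTO', hTf', rfl⟩ := Set.exists_subset_image_finite_and.1 ⟨T, hTO, hTf, rfl⟩
  refine ⟨⋂₀ T, ?_, hTf'.isOpen_sInter fun U hU => (hTO' hU).1.isOpen, fun U hU => (hTO' hU).2⟩
  rintro y hy ⟨C, hC, hyC⟩
  obtain ⟨_, ⟨U, hU, rfl⟩, hCU⟩ := hT hC
  have : y ∈ (C : Set X) ∩ U := ⟨hyC, hy U hU⟩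
  rw [show (C : Set X) ∩ U = ∅ from hCU] at this
  exact this

/-- The union of a closed set of closed sets. -/
def union (𝒞 : Hyperspace (Hyperspace X)) : Hyperspace X :=
  (⟨{x | ∃ C ∈ 𝒞, x ∈ C}, isClosed_union 𝒞⟩ : TopologicalSpace.Closeds X)

theorem mem_union (𝒞 : Hyperspace (Hyperspace X)) (x : X) : x ∈ union 𝒞 ↔ ∃ C ∈ 𝒞, x ∈ C :=
  Iff.rfl

theorem continuous_image (f : C(X, Y)) : Continuous (image f) := by
  refine continuous_of_hit _ fun U hU => ?_
  have : image f ⁻¹' hit U = hit (f ⁻¹' U) := by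
    ext C
    constructor
    · rintro ⟨_, ⟨x, hx, rfl⟩, hxU⟩
      exact ⟨x, hx, hxU⟩
    · rintro ⟨x, hx, hxU⟩
      exact ⟨f x, ⟨x, hx, rfl⟩, hxU⟩
  rw [this]
  exact isClopen_hit (hU.preimage f.continuous)

theorem continuous_singleton : Continuous (singleton : X → Hyperspace X) := by
  refine continuous_of_hit _ fun U hU => ?_
  have : singleton ⁻¹' hit U = U := by
    ext x
    constructor
    · rintro ⟨_, rfl, hxU⟩
      exact hxU
    · intro hx
      exact ⟨x, rfl, hx⟩
  rwa [this]

theorem continuous_union : Continuous (union : Hyperspace (Hyperspace X) → Hyperspace X) := by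
  refine continuous_of_hit _ fun U hU => ?_
  have : union ⁻¹' hit U = hit (hit U) := by
    ext 𝒞
    constructor
    · rintro ⟨x, ⟨C, hC, hx⟩, hxU⟩
      exact ⟨C, hC, x, hx, hxU⟩
    · rintro ⟨C, hC, x, hx, hxU⟩
      exact ⟨x, ⟨C, hC, hx⟩, hxU⟩
  rw [this]
  exact isClopen_hit (isClopen_hit hU)

theorem image_id (C : Hyperspace X) : image (ContinuousMap.id X) C = C :=
  Hyperspace.ext fun x => by simp [mem_image]

theorem image_comp {Z : Type u} [TopologicalSpace Z] [CompactSpace Z] [T2Space Z]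
    [TotallyDisconnectedSpace Z] (f : C(X, Y)) (g : C(Y, Z)) (C : Hyperspace X) :
    image (g.comp f) C = image g (image f C) :=
  Hyperspace.ext fun z => by simp [mem_image]

theorem singleton_apply (f : C(X, Y)) (x : X) : singleton (f x) = image f (singleton x) :=
  Hyperspace.ext fun y => by simp [mem_image, mem_singleton, eq_comm]

theorem union_image (f : C(X, Y)) (𝒞 : Hyperspace (Hyperspace X)) :
    union (image ⟨image f, continuous_image f⟩ 𝒞) = image f (union 𝒞) :=
  Hyperspace.ext fun y => by
    simp only [mem_union, mem_image, ContinuousMap.coe_mk]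
    constructor
    · rintro ⟨_, ⟨C, hC, rfl⟩, x, hx, rfl⟩
      exact ⟨x, ⟨C, hC, hx⟩, rfl⟩
    · rintro ⟨x, ⟨C, hC, hx⟩, rfl⟩
      exact ⟨_, ⟨C, hC, rfl⟩, x, hx, rfl⟩

theorem union_union (𝔠 : Hyperspace (Hyperspace (Hyperspace X))) :
    union (image ⟨union, continuous_union⟩ 𝔠) = union (union 𝔠) :=
  Hyperspace.ext fun x => by
    simp only [mem_union, mem_image, ContinuousMap.coe_mk]
    constructor
    · rintro ⟨_, ⟨𝒞, h𝒞, rfl⟩, C, hC, hx⟩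
      exact ⟨C, ⟨𝒞, h𝒞, hC⟩, hx⟩
    · rintro ⟨C, ⟨𝒞, h𝒞, hC⟩, hx⟩
      exact ⟨_, ⟨𝒞, h𝒞, rfl⟩, C, hC, hx⟩

theorem union_singleton (C : Hyperspace X) : union (singleton C) = C :=
  Hyperspace.ext fun x => by simp [mem_union, mem_singleton]

theorem union_image_singleton (C : Hyperspace X) :
    union (image ⟨singleton, continuous_singleton⟩ C) = C :=
  Hyperspace.ext fun x => by simp [mem_union, mem_image, mem_singleton]

end Hyperspace

/-- The Vietoris monad on the category of Stone spaces: `X` is sent to its Vietoris space, continuous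
maps act by direct image, the unit is `x ↦ {x}` and the multiplication is union. -/
def vietorisMonad : Monad Profinite.{u} where
  obj X := Profinite.of (Hyperspace X)
  map f := CompHausLike.ofHom _ ⟨image (ConcreteCategory.hom f), continuous_image _⟩
  map_id _ := ConcreteCategory.hom_ext _ _ fun C => image_id C
  map_comp _ _ := ConcreteCategory.hom_ext _ _ fun C => image_comp _ _ C
  η :=
    { app _ := CompHausLike.ofHom _ ⟨singleton, continuous_singleton⟩
      naturality _ Y f := ConcreteCategory.hom_ext _ _ fun x =>
        singleton_apply (Y := Y) (ConcreteCategory.hom (C := Profinite.{u}) f) x }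
  μ :=
    { app _ := CompHausLike.ofHom _ ⟨union, continuous_union⟩
      naturality _ Y f := ConcreteCategory.hom_ext _ _ fun 𝒞 =>
        union_image (Y := Y) (ConcreteCategory.hom (C := Profinite.{u}) f) 𝒞 }
  assoc _ := ConcreteCategory.hom_ext _ _ fun 𝔠 => union_union 𝔠
  left_unit _ := ConcreteCategory.hom_ext _ _ fun C => union_singleton C
  right_unit _ := ConcreteCategory.hom_ext _ _ fun C => union_image_singleton C

/-! ## The dual adjunction between Stone spaces and join-semilattices with bottom -/

section Dual

instance boolContinuousSup : ContinuousSup Bool := ⟨continuous_of_discreteTopology⟩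

instance continuousMapOrderBot (X : Type u) [TopologicalSpace X] : OrderBot C(X, Bool) where
  bot := ContinuousMap.const X ⊥
  bot_le _ := fun _ => bot_le

/-- `JSL(J, 2)` as a subspace of the product space `2^J`, with `2` discrete. -/
instance idealTopology (J : Type u) [SemilatticeSup J] [OrderBot J] : TopologicalSpace (SupBotHom J Bool) :=
  TopologicalSpace.induced (fun φ : SupBotHom J Bool => (φ : J → Bool)) inferInstance

variable {J : Type u} [SemilatticeSup J] [OrderBot J]

theorem isEmbedding_coe : Topology.IsEmbedding (fun φ : SupBotHom J Bool => (φ : J → Bool)) :=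
  ⟨⟨rfl⟩, DFunLike.coe_injective⟩

theorem isClosedEmbedding_coe :
    Topology.IsClosedEmbedding (fun φ : SupBotHom J Bool => (φ : J → Bool)) := by
  refine ⟨isEmbedding_coe, ?_⟩
  have : Set.range (fun φ : SupBotHom J Bool => (φ : J → Bool)) =
      {g : J → Bool | (∀ a b, g (a ⊔ b) = (g a ⊔ g b)) ∧ g ⊥ = ⊥} := by
    ext g
    constructor
    · rintro ⟨φ, rfl⟩
      exact ⟨fun a b => map_sup φ a b, map_bot φ⟩
    · rintro ⟨h1, h2⟩
      exact ⟨⟨⟨g, h1⟩, h2⟩, rfl⟩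
  rw [this, Set.ofPred_and, Set.ofPred_forall]
  simp only [Set.ofPred_forall]
  refine IsClosed.inter (isClosed_iInter fun a => isClosed_iInter fun b => ?_) ?_
  · exact isClosed_eq (continuous_apply _) ((continuous_apply a).sup (continuous_apply b))
  · exact isClosed_eq (continuous_apply _) continuous_const

theorem continuous_eval (a : J) : Continuous fun φ : SupBotHom J Bool => φ a :=
  (continuous_apply a).comp isEmbedding_coe.continuous

theorem continuous_of_eval {Z : Type*} [TopologicalSpace Z] (f : Z → SupBotHom J Bool)
    (h : ∀ a, Continuous fun z => f z a) : Continuous f :=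
  isEmbedding_coe.continuous_iff.2 (continuous_pi h)

instance idealCompact : CompactSpace (SupBotHom J Bool) := isClosedEmbedding_coe.compactSpace

instance idealT2 : T2Space (SupBotHom J Bool) := isEmbedding_coe.t2Space

instance idealTotallyDisconnected : TotallyDisconnectedSpace (SupBotHom J Bool) :=
  isEmbedding_coe.isTotallyDisconnected_range.1
    (isTotallyDisconnected_of_totallyDisconnectedSpace _)

end Dual

/-- The functor `Stone(-, 2)` from Stone spaces to the opposite of the category of join-semilattices
with bottom; `2` is the discrete space `Bool`, and joins are computed pointwise. -/
def stoneHom : Profinite.{u} ⥤ SemilatSupCat.{u}ᵒᵖ where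
  obj X := Opposite.op (SemilatSupCat.of C(X, Bool))
  map {X Y} f := Quiver.Hom.op (X := SemilatSupCat.of C(Y, Bool)) (Y := SemilatSupCat.of C(X, Bool))
    (⟨⟨fun g => g.comp (ConcreteCategory.hom f), fun _ _ => rfl⟩, rfl⟩ :
      SupBotHom C(Y, Bool) C(X, Bool))

/-- The functor `JSL(-, 2)` from the opposite of the category of join-semilattices with bottom to
Stone spaces. -/
def idealSpace : SemilatSupCat.{u}ᵒᵖ ⥤ Profinite.{u} where
  obj J := Profinite.of (SupBotHom J.unop Bool)
  map {J K} h := CompHausLike.ofHom _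
    (⟨fun φ => SupBotHom.comp φ h.unop,
      continuous_of_eval _ fun _ => continuous_eval _⟩ :
      C(SupBotHom J.unop Bool, SupBotHom K.unop Bool))

/-- A morphism `J → Stone(X, 2)` gives a continuous map `X → JSL(J, 2)`. -/
def transpose {X J : Type u} [TopologicalSpace X] [SemilatticeSup J] [OrderBot J]
    (h : SupBotHom J C(X, Bool)) : C(X, SupBotHom J Bool) where
  toFun x :=
    { toFun := fun a => h a x
      map_sup' := fun a b => by rw [map_sup]; rfl
      map_bot' := by rw [map_bot]; rfl }
  continuous_toFun := continuous_of_eval _ fun a => (h a).continuous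

/-- A continuous map `X → JSL(J, 2)` gives a morphism `J → Stone(X, 2)`. -/
def untranspose {X J : Type u} [TopologicalSpace X] [SemilatticeSup J] [OrderBot J]
    (f : C(X, SupBotHom J Bool)) : SupBotHom J C(X, Bool) where
  toFun a := ⟨fun x => f x a, (continuous_eval a).comp f.continuous⟩
  map_sup' a b := ContinuousMap.ext fun x => map_sup (f x) a b
  map_bot' := ContinuousMap.ext fun x => map_bot (f x)

/-- The dual adjunction `Stone(-, 2) ⊣ JSL(-, 2)`: a continuous map `X → JSL(J, 2)` corresponds to a
morphism `J → Stone(X, 2)` by exchanging the two arguments. -/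
def dualAdjunction : stoneHom.{u} ⊣ idealSpace.{u} :=
  Adjunction.mkOfHomEquiv
    { homEquiv X J :=
        { toFun h := CompHausLike.ofHom _ (transpose (X := X) (J := J.unop) h.unop)
          invFun f := Quiver.Hom.op (X := J.unop) (Y := SemilatSupCat.of C(X, Bool))
            (untranspose (X := X) (J := J.unop) (ConcreteCategory.hom (C := Profinite.{u}) f))
          left_inv _ := rfl
          right_inv _ := rfl }
      homEquiv_naturality_left_symm _ _ := rfl
      homEquiv_naturality_right _ _ := rfl }

/-! ## Finite sets and finite powersets -/

section FinitePowerset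

variable {X Y : Type u}

open scoped Classical in
/-- The direct image of a finite set. -/
def finsetMap (f : X → Y) (s : Finset X) : Finset Y := s.image f

open scoped Classical in
/-- The union of a finite set of finite sets. -/
def finsetUnion (S : Finset (Finset X)) : Finset X := S.biUnion id

theorem mem_finsetMap (f : X → Y) (s : Finset X) (y : Y) :
    y ∈ finsetMap f s ↔ ∃ x ∈ s, f x = y := by
  classical exact Finset.mem_image

theorem mem_finsetUnion (S : Finset (Finset X)) (x : X) :
    x ∈ finsetUnion S ↔ ∃ s ∈ S, x ∈ s := by
  classical exact Finset.mem_biUnion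

/-- The finite powerset monad on the category of sets: functions act by direct image, the unit is
`x ↦ {x}` and the multiplication is union. -/
def finitePowersetMonad : Monad (Type u) where
  obj X := Finset X
  map f := ↾(finsetMap f)
  map_id X := ConcreteCategory.hom_ext _ _ fun (s : Finset X) => by
    change finsetMap id s = s
    ext
    simp [mem_finsetMap]
  map_comp {X _ _} f g := ConcreteCategory.hom_ext _ _ fun (s : Finset X) => by
    change finsetMap (fun x => g (f x)) s = finsetMap g (finsetMap f s)
    ext
    simp [mem_finsetMap]
  η :=
    { app X := ↾(fun x : X => ({x} : Finset X))
      naturality _ _ f := ConcreteCategory.hom_ext _ _ fun x => by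
        change {f x} = finsetMap f {x}
        ext
        simp [mem_finsetMap, eq_comm] }
  μ :=
    { app X := ↾(finsetUnion (X := X))
      naturality X _ f := ConcreteCategory.hom_ext _ _ fun (S : Finset (Finset X)) => by
        change finsetUnion (finsetMap (finsetMap f) S) = finsetMap f (finsetUnion S)
        ext
        simp only [mem_finsetMap, mem_finsetUnion]
        grind [mem_finsetMap] }
  assoc X := ConcreteCategory.hom_ext _ _ fun (S : Finset (Finset (Finset X))) => by
    change finsetUnion (finsetMap finsetUnion S) = finsetUnion (finsetUnion S)
    ext
    simp only [mem_finsetMap, mem_finsetUnion]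
    grind [mem_finsetUnion]
  left_unit X := ConcreteCategory.hom_ext _ _ fun (s : Finset X) => by
    change finsetUnion {s} = s
    ext
    simp [mem_finsetUnion]
  right_unit X := ConcreteCategory.hom_ext _ _ fun (s : Finset X) => by
    change finsetUnion (finsetMap (fun x => {x}) s) = s
    ext
    simp [mem_finsetUnion, mem_finsetMap]

/-- The full subcategory of the Kleisli category of the finite powerset monad on the finite sets. -/
abbrev FiniteKleisli : Type (u + 1) :=
  ObjectProperty.FullSubcategory (fun X : Kleisli finitePowersetMonad.{u} => Finite X.of)

/-- The set of finite subsets of `X` with the discrete topology. -/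
def DiscretePowerset (X : Type u) : Type u := Finset X

instance discretePowersetTopology (X : Type u) : TopologicalSpace (DiscretePowerset X) := ⊥

instance discretePowersetDiscrete (X : Type u) : DiscreteTopology (DiscretePowerset X) := ⟨rfl⟩

instance discretePowersetFinite (X : Type u) [Finite X] : Finite (DiscretePowerset X) :=
  inferInstanceAs (Finite (Finset X))

instance finiteKleisliFinite (X : FiniteKleisli.{u}) : Finite X.obj.of := X.property

/-- The functor sending a finite set `X` to the finite powerset of `X`, as a discrete space, and a
Kleisli morphism `f` to `f^#`, that is, to `P f` followed by the multiplication of the monad. -/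
def kleisliToStone : FiniteKleisli.{u} ⥤ Profinite.{u} where
  obj X := Profinite.of (DiscretePowerset X.obj.of)
  map {X Y} f := CompHausLike.ofHom _
    (⟨(Kleisli.Adjunction.fromKleisli finitePowersetMonad).map f.hom,
      continuous_of_discreteTopology⟩ :
      C(DiscretePowerset X.obj.of, DiscretePowerset Y.obj.of))
  map_id X := ConcreteCategory.hom_ext _ _ fun s =>
    ConcreteCategory.congr_hom ((Kleisli.Adjunction.fromKleisli finitePowersetMonad).map_id X.obj) s
  map_comp f g := ConcreteCategory.hom_ext _ _ fun s =>
    ConcreteCategory.congr_hom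
      ((Kleisli.Adjunction.fromKleisli finitePowersetMonad).map_comp f.hom g.hom) s

end FinitePowerset

end VietorisCodensity

end

/-! A closed set of a Stone space is the complement of the union of the clopen sets that it misses,
and by compactness every ideal of clopen sets arises in this way, so `𝕍` is the monad of the dual
adjunction `F ⊣ G` with `F = Stone(-, 2)` and `G = JSL(-, 2)`. A subset of a finite set `A` is
determined by the subsets of `A` that it meets, so `U_{P_f} ≅ G L`, where `L` sends `A` to the free
join-semilattice `P A`. The functor `L` is codense in `JSLᵒᵖ`: an element of a join-semilattice `J`
is a morphism to `J` from the free join-semilattice on one generator, and a join of two elements is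
seen on two generators. Finally, whenever `F ⊣ G` and `L` is codense, a cone over the objects
`G L a` under `X` is the same as a cone over the objects `L a` under `F X`, so `G F` is the
pointwise right Kan extension of `G L` along itself. -/

universe v₃ u₃

noncomputable section

namespace VietorisCodensity

section Recognition

variable {A : Type u₁} {C : Type u₂} [Category.{v₁} A] [Category.{v₂} C]
variable (U : A ⥤ C) [U.HasRightKanExtension U] {T : C ⥤ C} (α : U ⋙ T ⟶ U) (β : T ⟶ ranSelf U)

theorem comp_eq_codensityUnit (η : 𝟭 C ⟶ T)
    (hβ : ∀ a, β.app (U.obj a) ≫ (ranSelfCounit U).app a = α.app a)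
    (hη : ∀ a, η.app (U.obj a) ≫ α.app a = 𝟙 (U.obj a)) : η ≫ β = codensityUnit U := by
  apply (ranSelf U).hom_ext_of_isRightKanExtension (ranSelfCounit U)
  ext a
  have hunit := codensityUnit_fac U a
  simp only [Functor.whiskerLeft_app, NatTrans.comp_app, Category.assoc, hβ, hη, hunit]

theorem comp_eq_hcomp_comp_codensityMul (μ : T ⋙ T ⟶ T)
    (hβ : ∀ a, β.app (U.obj a) ≫ (ranSelfCounit U).app a = α.app a)
    (hμ : ∀ a, μ.app (U.obj a) ≫ α.app a = T.map (α.app a) ≫ α.app a) :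
    μ ≫ β = (β ◫ β) ≫ codensityMul U := by
  apply (ranSelf U).hom_ext_of_isRightKanExtension (ranSelfCounit U)
  ext a
  have hmul := codensityMul_fac U a
  simp only [Functor.whiskerLeft_app, NatTrans.comp_app, NatTrans.hcomp_app, Category.assoc]
  rw [hβ, hμ, ← hβ, Functor.map_comp_assoc]
  simp [hmul]

/-- A monad is the codensity monad of `U` if its functor is the right Kan extension of `U` along
itself by a natural transformation `α` that satisfies the laws of an algebra. -/
def monadIsoCodensity (T : Monad C) (α : U ⋙ (T : C ⥤ C) ⟶ U)
    [(T : C ⥤ C).IsRightKanExtension α]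
    (hη : ∀ a, T.η.app (U.obj a) ≫ α.app a = 𝟙 (U.obj a))
    (hμ : ∀ a, T.μ.app (U.obj a) ≫ α.app a = T.map (α.app a) ≫ α.app a) :
    T ≅ codensityMonad U :=
  let β := (T : C ⥤ C).rightKanExtensionUnique α (ranSelf U) (ranSelfCounit U)
  have hβ (a : A) : β.hom.app (U.obj a) ≫ (ranSelfCounit U).app a = α.app a := by
    simp [β, Functor.rightKanExtensionUnique, Functor.rightKanExtensionUniqueOfIso]
  MonadIso.mk (N := codensityMonad U) β
    (NatTrans.congr_app (comp_eq_codensityUnit U α β.hom T.η hβ hη))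
    (fun X => (NatTrans.congr_app
      (comp_eq_hcomp_comp_codensityMul U α β.hom T.μ hβ hμ) X).trans <| by
        simp [NatTrans.hcomp_app, codensityMonad])

end Recognition

section DualAdjunction

variable {A : Type u₁} {C : Type u₂} {D : Type u₃}
variable [Category.{v₁} A] [Category.{v₂} C] [Category.{v₃} D]

/-- The cone with apex `Y` over the objects `L.obj a`, indexed by the morphisms `Y ⟶ L.obj a`. -/
def arrowCone (L : A ⥤ D) (Y : D) : Limits.Cone (StructuredArrow.proj Y L ⋙ L) where
  pt := Y
  π :=
    { app h := h.hom
      naturality _ _ f := (Category.id_comp _).trans (StructuredArrow.w f).symm }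

/-- `L` is codense when every object `Y` is the limit of the objects `L.obj a` over all morphisms
`Y ⟶ L.obj a`. -/
def IsCodense (L : A ⥤ D) : Prop :=
  ∀ Y : D, Nonempty (Limits.IsLimit (arrowCone L Y))

variable {F : C ⥤ D} {G : D ⥤ C} (adj : F ⊣ G) {L : A ⥤ D} {U : A ⥤ C} (e : U ≅ L ⋙ G)

/-- The natural transformation `F U ⟶ L` that corresponds to `e : U ≅ G L` under the
adjunction. -/
def adjunct : U ⋙ F ⟶ L where
  app a := (adj.homEquiv (U.obj a) (L.obj a)).symm (e.hom.app a)
  naturality a b f := by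
    have he := e.hom.naturality f
    simp only [Functor.comp_map, ← Adjunction.homEquiv_naturality_left_symm,
      ← Adjunction.homEquiv_naturality_right_symm] at he ⊢
    rw [he]

theorem map_inv_app_comp_adjunct (a : A) :
    F.map (e.inv.app a) ≫ (adjunct adj e).app a = adj.counit.app (L.obj a) := by
  simp [adjunct, ← Adjunction.homEquiv_naturality_left_symm, Adjunction.homEquiv_symm_id]

/-- The transposition `D(F X, L a) ≃ C(X, U a)`. -/
def transposeEquiv (X : C) (a : A) : (F.obj X ⟶ L.obj a) ≃ (X ⟶ U.obj a) where
  toFun h := adj.homEquiv X (L.obj a) h ≫ e.inv.app a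
  invFun p := F.map p ≫ (adjunct adj e).app a
  left_inv h := by
    simp [map_inv_app_comp_adjunct, ← Adjunction.homEquiv_counit]
  right_inv p := by
    simp [adjunct, Adjunction.homEquiv_naturality_left]

/-- The action of the monad `G F` on `U ≅ G L` by the counit of the adjunction. -/
def counitAction : U ⋙ F ⋙ G ⟶ U :=
  Functor.whiskerRight (adjunct adj e) G ≫ e.inv

theorem homEquiv_comp_map_comp_counitAction {X Z : C} {a : A} (g : F.obj Z ⟶ F.obj X)
    (p : X ⟶ U.obj a) :
    adj.homEquiv Z (F.obj X) g ≫ G.map (F.map p) ≫ (counitAction adj e).app a =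
      transposeEquiv adj e Z a (g ≫ (transposeEquiv adj e X a).symm p) := by
  simp [counitAction, transposeEquiv, Adjunction.homEquiv_naturality_right]

theorem unit_comp_counitAction (a : A) :
    adj.unit.app (U.obj a) ≫ (counitAction adj e).app a = 𝟙 (U.obj a) := by
  have h := homEquiv_comp_map_comp_counitAction adj e (𝟙 _) (𝟙 (U.obj a))
  simpa [Adjunction.homEquiv_id] using h

theorem map_counit_comp_counitAction (a : A) :
    G.map (adj.counit.app (F.obj (U.obj a))) ≫ (counitAction adj e).app a =
      G.map (F.map ((counitAction adj e).app a)) ≫ (counitAction adj e).app a := by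
  have h : adj.counit.app (F.obj (U.obj a)) ≫ (adjunct adj e).app a =
      F.map (G.map ((adjunct adj e).app a)) ≫ F.map (e.inv.app a) ≫ (adjunct adj e).app a := by
    rw [map_inv_app_comp_adjunct]
    exact (adj.counit.naturality _).symm
  simp only [counitAction, NatTrans.comp_app, Functor.whiskerRight_app,
    ← Functor.map_comp_assoc, h]

/-- Transposition as a functor from the arrows `F.obj X ⟶ L.obj a` to the arrows
`X ⟶ U.obj a`. -/
def transposeArrow (X : C) : StructuredArrow (F.obj X) L ⥤ StructuredArrow X U where
  obj h := StructuredArrow.mk (transposeEquiv adj e X h.right h.hom)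
  map {h k} f := StructuredArrow.homMk f.right (by
    have hinv := e.inv.naturality f.right
    simp only [Functor.comp_map] at hinv
    simp [transposeEquiv, ← hinv, ← reassoc_of% adj.homEquiv_naturality_right])

/-- The cone over the objects `L.obj a` under `F.obj X` whose legs are the transposes of the legs
of a cone over the objects `U.obj a` under `X`. -/
def transposeCone {X : C} (s : Limits.Cone (StructuredArrow.proj X U ⋙ U)) :
    Limits.Cone (StructuredArrow.proj (F.obj X) L ⋙ L) :=
  (Limits.Cone.postcompose
    (Functor.whiskerLeft (StructuredArrow.proj (F.obj X) L) (adjunct adj e))).obj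
    (F.mapCone (s.whisker (transposeArrow adj e X)))

theorem homEquiv_comp_map_comp_counitAction_eq_iff {X Z : C} {a : A} (g : F.obj Z ⟶ F.obj X)
    (h : F.obj X ⟶ L.obj a) (q : Z ⟶ U.obj a) :
    adj.homEquiv Z (F.obj X) g ≫ G.map (F.map (transposeEquiv adj e X a h)) ≫
        (counitAction adj e).app a = q ↔
      g ≫ h = (transposeEquiv adj e Z a).symm q := by
  rw [homEquiv_comp_map_comp_counitAction, Equiv.symm_apply_apply, Equiv.eq_symm_apply]

/-- The monad `G F` as pointwise right Kan extension of `U ≅ G L` along itself, for codense `L`: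
transposition turns the cones over the objects `U.obj a` under `X` into the cones over the objects
`L.obj a` under `F.obj X`. -/
def counitActionIsPointwise (hL : IsCodense L) :
    (Functor.RightExtension.mk (F ⋙ G) (counitAction adj e)).IsPointwiseRightKanExtension :=
  fun X =>
  have hX := (hL (F.obj X)).some
  { lift s := adj.homEquiv s.pt (F.obj X) (hX.lift (transposeCone adj e s))
    fac s p := by
      obtain ⟨h, rfl⟩ : ∃ h, (transposeArrow adj e X).obj h = p :=
        ⟨.mk ((transposeEquiv adj e X p.right).symm p.hom),
          congrArg StructuredArrow.mk (Equiv.apply_symm_apply _ p.hom)⟩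
      exact (homEquiv_comp_map_comp_counitAction_eq_iff adj e _ _ _).2
        (hX.fac (transposeCone adj e s) h)
    uniq s m hm := ((adj.homEquiv _ _).symm_apply_eq).1 <|
      hX.uniq (transposeCone adj e s) _ fun h =>
        (homEquiv_comp_map_comp_counitAction_eq_iff adj e _ _ _).1 <|
          (congrArg (· ≫ _) (Equiv.apply_symm_apply _ m)).trans
            (hm ((transposeArrow adj e X).obj h)) }

/-- For codense `L`, the monad of `F ⊣ G` is the codensity monad of `G L`. -/
def monadIsoCodensityOfIsCodense [U.HasRightKanExtension U] (hL : IsCodense L) :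
    adj.toMonad ≅ codensityMonad U :=
  have : (adj.toMonad : C ⥤ C).IsRightKanExtension (counitAction adj e) :=
    (counitActionIsPointwise adj e hL).isRightKanExtension
  monadIsoCodensity U adj.toMonad (counitAction adj e) (unit_comp_counitAction adj e)
    (map_counit_comp_counitAction adj e)

end DualAdjunction

section Subsets

variable {α : Type*}

open scoped Classical in
/-- The morphism `P α → 2` of join-semilattices whose kernel is the ideal of all sets disjoint from
`S`. -/
def meetsHom (S : Set α) : SupBotHom (Set α) Bool where
  toFun T := decide (S ∩ T).Nonempty
  map_sup' T T' := by simp [Set.inter_union_distrib_left, Set.union_nonempty]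
  map_bot' := by simp

theorem meetsHom_eq_true_iff {S T : Set α} : meetsHom S T = true ↔ (S ∩ T).Nonempty := by
  simp [meetsHom]

theorem meetsHom_singleton_eq_true_iff {S : Set α} {a : α} : meetsHom S {a} = true ↔ a ∈ S := by
  simp [meetsHom_eq_true_iff]

variable {X : Type u} [TopologicalSpace X]

/-- The morphism of join-semilattices `Stone(X, 2) → P X` given by `g ↦ g⁻¹(1)`. -/
def supportHom : SupBotHom C(X, Bool) (Set X) where
  toFun g := g ⁻¹' {true}
  map_sup' g h := Set.ext fun _ => Bool.or_eq_true_iff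
  map_bot' := Set.ext fun x => by simp [show (⊥ : C(X, Bool)) x = false from rfl]

end Subsets

section Ideals

variable {X : Type u} [TopologicalSpace X]

theorem isClopen_support (g : C(X, Bool)) : IsClopen (supportHom g) :=
  (isClopen_discrete {true}).preimage g.continuous

/-- The morphism `φ_C` with `φ_C(g) = 0` if and only if `C` misses `g⁻¹(1)`. -/
def hitHom (C : Hyperspace X) : SupBotHom C(X, Bool) Bool :=
  (meetsHom (C : Set X)).comp supportHom

theorem hitHom_eq_true_iff_mem_hit {C : Hyperspace X} {g : C(X, Bool)} :
    hitHom C g = true ↔ C ∈ hit (supportHom g) :=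
  meetsHom_eq_true_iff

theorem hitHom_eq_true_iff {C : Hyperspace X} {g : C(X, Bool)} :
    hitHom C g = true ↔ ∃ x ∈ C, g x = true :=
  meetsHom_eq_true_iff

theorem hitHom_eq_false_iff {C : Hyperspace X} {g : C(X, Bool)} :
    hitHom C g = false ↔ C ∈ miss (g ⁻¹' {true}) := by
  rw [← Bool.not_eq_true, hitHom_eq_true_iff_mem_hit, ← compl_hit]
  rfl

theorem continuous_hitHom : Continuous (hitHom (X := X)) := by
  refine continuous_of_eval _ fun g => (continuous_bool_rng true).2 ?_
  convert isClopen_hit (isClopen_support g) using 1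
  ext C
  exact hitHom_eq_true_iff_mem_hit

/-- The closed set of the points that lie in no clopen set of the ideal `φ⁻¹(0)`. -/
def zeroLocus (φ : SupBotHom C(X, Bool) Bool) : Hyperspace X :=
  (⟨⋂ (g : C(X, Bool)) (_ : φ g = false), g ⁻¹' {false},
    isClosed_biInter fun g _ => isClosed_singleton.preimage g.continuous⟩ :
      TopologicalSpace.Closeds X)

theorem mem_zeroLocus {φ : SupBotHom C(X, Bool) Bool} {x : X} :
    x ∈ zeroLocus φ ↔ ∀ g, φ g = false → g x = false :=
  Set.mem_iInter₂

variable [CompactSpace X]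

/- By compactness, `g⁻¹(1)` is covered by finitely many members of the ideal `φ⁻¹(0)`, hence by
their join. -/
theorem exists_le_of_forall_notMem_zeroLocus (φ : SupBotHom C(X, Bool) Bool) (g : C(X, Bool))
    (hg : ∀ x ∈ zeroLocus φ, g x = false) : ∃ h, φ h = false ∧ g ≤ h := by
  let I := {h : C(X, Bool) // φ h = false}
  have : Nonempty I := ⟨⊥, map_bot φ⟩
  have hcover : supportHom g ⊆ ⋃ h : I, supportHom h.1 := by
    intro x hx
    have hxφ : x ∉ zeroLocus φ := fun hxφ => Bool.false_ne_true ((hg x hxφ).symm.trans hx)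
    simp only [mem_zeroLocus, not_forall, Bool.not_eq_false] at hxφ
    obtain ⟨h, hφ, hxh⟩ := hxφ
    exact Set.mem_iUnion.2 ⟨⟨h, hφ⟩, hxh⟩
  have hdirected : Directed (· ⊆ ·) fun h : I => supportHom h.1 := fun h k =>
    ⟨⟨h.1 ⊔ k.1, by rw [map_sup, h.2, k.2]; rfl⟩,
      OrderHomClass.mono supportHom le_sup_left, OrderHomClass.mono supportHom le_sup_right⟩
  obtain ⟨h, hgh⟩ := (isClopen_support g).isClosed.isCompact.elim_directed_cover _
    (fun h : I => (isClopen_support h.1).isOpen) hcover hdirected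
  exact ⟨h.1, h.2, fun x => Bool.le_iff_imp.2 fun hx => hgh hx⟩

theorem hitHom_zeroLocus (φ : SupBotHom C(X, Bool) Bool) : hitHom (zeroLocus φ) = φ := by
  refine DFunLike.ext _ _ fun g => Bool.eq_iff_iff.2 ⟨fun hg => ?_, fun hg => ?_⟩
  · obtain ⟨x, hx, hgx⟩ := hitHom_eq_true_iff.1 hg
    by_contra hφ
    simp [mem_zeroLocus.1 hx g (Bool.eq_false_iff.2 hφ)] at hgx
  · rw [hitHom_eq_true_iff]
    by_contra! hC
    obtain ⟨h, hφ, hgh⟩ := exists_le_of_forall_notMem_zeroLocus φ g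
      fun x hx => Bool.eq_false_iff.2 (hC x hx)
    have hle := OrderHomClass.mono φ hgh
    rw [hg, hφ] at hle
    exact absurd hle (by decide)

variable [T2Space X] [TotallyDisconnectedSpace X]

theorem zeroLocus_hitHom (C : Hyperspace X) : zeroLocus (hitHom C) = C := by
  refine Hyperspace.ext fun x => ⟨fun hx => ?_, fun hx => mem_zeroLocus.2 fun g hg => ?_⟩
  · by_contra hxC
    obtain ⟨V, hV, hxV, hCV⟩ := exists_clopen_of_notMem C hxC
    let g : C(X, Bool) := ⟨V.boolIndicator, (continuous_boolIndicator_iff_isClopen V).2 hV⟩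
    have hg : hitHom C g = false :=
      hitHom_eq_false_iff.2 (by rwa [ContinuousMap.coe_mk, V.preimage_boolIndicator_true])
    have hgx : g x = false := mem_zeroLocus.1 hx g hg
    exact (V.notMem_iff_boolIndicator x).2 hgx hxV
  · by_contra hgx
    exact Bool.eq_false_iff.1 hg (hitHom_eq_true_iff.2 ⟨x, hx, Bool.eq_true_of_not_eq_false hgx⟩)

/-- Closed sets correspond to ideals of clopen sets. -/
def hyperspaceHomeo : Hyperspace X ≃ₜ SupBotHom C(X, Bool) Bool :=
  Continuous.homeoOfEquivCompactToT2
    (f := ⟨hitHom, zeroLocus, zeroLocus_hitHom, hitHom_zeroLocus⟩) continuous_hitHom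

theorem hitHom_image {Y : Type u} [TopologicalSpace Y] [CompactSpace Y] [T2Space Y]
    [TotallyDisconnectedSpace Y] (f : C(X, Y)) (C : Hyperspace X) (g : C(Y, Bool)) :
    hitHom (image f C) g = hitHom C (g.comp f) := by
  rw [Bool.eq_iff_iff, hitHom_eq_true_iff, hitHom_eq_true_iff]
  simp [mem_image]

theorem hitHom_singleton (x : X) (g : C(X, Bool)) : hitHom (singleton x) g = g x := by
  rw [Bool.eq_iff_iff, hitHom_eq_true_iff]
  simp [mem_singleton]

theorem hitHom_union (𝒞 : Hyperspace (Hyperspace X)) (g : C(X, Bool)) :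
    hitHom (union 𝒞) g =
      hitHom 𝒞 ⟨fun C => hitHom C g, (continuous_eval g).comp continuous_hitHom⟩ := by
  rw [Bool.eq_iff_iff, hitHom_eq_true_iff, hitHom_eq_true_iff]
  simp only [mem_union, ContinuousMap.coe_mk, hitHom_eq_true_iff]
  grind

end Ideals

/-- The isomorphism between the Vietoris monad and the monad of the dual adjunction. -/
def vietorisIso : vietorisMonad.{u} ≅ dualAdjunction.{u}.toMonad :=
  MonadIso.mk
    (NatIso.ofComponents
      (fun X => CompHausLike.isoOfHomeo
        (X := Profinite.of (Hyperspace X)) (Y := Profinite.of (SupBotHom C(X, Bool) Bool))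
        hyperspaceHomeo)
      (fun {X Y} f => ConcreteCategory.hom_ext _ _ fun (C : Hyperspace X) =>
        DFunLike.ext (F := SupBotHom C(Y, Bool) Bool) _ _
          (hitHom_image (Y := Y) (ConcreteCategory.hom (C := Profinite.{u}) f) C)))
    (fun X => ConcreteCategory.hom_ext _ _ fun (x : X) =>
      DFunLike.ext (F := SupBotHom C(X, Bool) Bool) _ _ (hitHom_singleton x))
    (fun X => ConcreteCategory.hom_ext _ _ fun (𝒞 : Hyperspace (Hyperspace X)) =>
      DFunLike.ext (F := SupBotHom C(X, Bool) Bool) _ _ fun g => by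
        change hitHom (union 𝒞) g = hitHom (image ⟨hitHom, continuous_hitHom⟩ 𝒞)
          ⟨fun φ : SupBotHom C(X, Bool) Bool => φ g, continuous_eval g⟩
        rw [hitHom_union, hitHom_image]
        rfl)

section FreeSemilattices

variable {α β : Type*} {J : Type*} [SemilatticeSup J] [OrderBot J]

/-- The morphism of join-semilattices `P β → P α` that sends `T` to the set of all elements related
to an element of `T` by the relation `k`. -/
def preimageHom (k : α → Finset β) : SupBotHom (Set β) (Set α) where
  toFun T := {a | ∃ b ∈ k a, b ∈ T}
  map_sup' T T' := Set.ext fun a => by simp [and_or_left, exists_or]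
  map_bot' := by simp

theorem mem_preimageHom {k : α → Finset β} {T : Set β} {a : α} :
    a ∈ preimageHom k T ↔ ∃ b ∈ k a, b ∈ T :=
  Iff.rfl

variable [Finite α]

theorem supBotHom_ext_singleton {φ ψ : SupBotHom (Set α) J} (h : ∀ a, φ {a} = ψ {a}) :
    φ = ψ := by
  refine DFunLike.ext φ ψ fun S => ?_
  induction S, S.toFinite using Set.Finite.induction_on with
  | empty => exact (map_bot φ).trans (map_bot ψ).symm
  | @insert a S _ _ hS =>
    have hsup (χ : SupBotHom (Set α) J) : χ (insert a S) = χ {a} ⊔ χ S := map_sup χ {a} S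
    rw [hsup, hsup, h, hS]

open scoped Classical in
/-- The morphism out of the free join-semilattice `P α` on a finite set `α` that extends `g`. -/
def freeHom (g : α → J) : SupBotHom (Set α) J where
  toFun S := S.toFinite.toFinset.sup g
  map_sup' S T := by
    simp only [Set.sup_eq_union, Set.Finite.toFinset_union S.toFinite T.toFinite, Finset.sup_union]
  map_bot' := by simp

theorem freeHom_singleton (g : α → J) (a : α) : freeHom g {a} = g a := by
  simp [freeHom]

/-- The universal property of the free join-semilattice on a finite set. -/
def freeHomEquiv : SupBotHom (Set α) J ≃ (α → J) where
  toFun φ a := φ {a}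
  invFun := freeHom
  left_inv φ := supBotHom_ext_singleton fun a => freeHom_singleton (fun a => φ {a}) a
  right_inv g := funext fun a => freeHom_singleton g a

theorem meetsHom_bijective : Function.Bijective (meetsHom (α := α)) := by
  refine ⟨fun S T h => Set.ext fun a => ?_, fun φ => ⟨{a | φ {a} = true}, ?_⟩⟩
  · rw [← meetsHom_singleton_eq_true_iff, h, meetsHom_singleton_eq_true_iff]
  · exact supBotHom_ext_singleton fun a => Bool.eq_iff_iff.2 meetsHom_singleton_eq_true_iff

end FreeSemilattices

section FinitePowersets

variable {α : Type u} [Finite α]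

variable (α) in
/-- Subsets of a finite set `α` correspond to morphisms `P α → 2`. -/
def meetsHomeo : DiscretePowerset α ≃ₜ SupBotHom (Set α) Bool :=
  Continuous.homeoOfEquivCompactToT2
    (f := (Equiv.ofBijective (fun s : Finset α => (s : Set α)) ⟨Finset.coe_injective,
      fun S => ⟨S.toFinite.toFinset, S.toFinite.coe_toFinset⟩⟩).trans
        (Equiv.ofBijective meetsHom meetsHom_bijective))
    continuous_of_discreteTopology

variable (α) in
/-- Subsets of a finite set `α` correspond to maps `α → 2`. -/
def powersetHomeo : DiscretePowerset α ≃ₜ (α → Bool) :=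
  (meetsHomeo α).trans <| Continuous.homeoOfEquivCompactToT2 (f := freeHomEquiv)
    (continuous_pi fun a => continuous_eval {a})

theorem powersetHomeo_apply (s : Finset α) (a : α) :
    powersetHomeo α s a = true ↔ a ∈ s :=
  meetsHom_singleton_eq_true_iff

end FinitePowersets

section KleisliMorphisms

theorem mem_finsetUnion_finsetMap {α β : Type u} (k : α → Finset β) (s : Finset α) (b : β) :
    b ∈ finsetUnion (finsetMap k s) ↔ ∃ a ∈ s, b ∈ k a := by
  simp only [mem_finsetUnion, mem_finsetMap, exists_exists_and_eq_and]

variable {A B C : FiniteKleisli.{u}}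

/-- The relation that underlies a Kleisli morphism. -/
def relation (f : A ⟶ B) : A.obj.of → Finset B.obj.of :=
  ConcreteCategory.hom f.hom.of

/-- The Kleisli morphism with underlying relation `k`. -/
def kleisliHom (k : A.obj.of → Finset B.obj.of) : A ⟶ B :=
  ObjectProperty.homMk (.mk (↾k))

theorem mem_relation_id {a b : A.obj.of} : b ∈ relation (𝟙 A) a ↔ b = a :=
  Finset.mem_singleton

theorem mem_relation_comp (f : A ⟶ B) (g : B ⟶ C) {a : A.obj.of} {c : C.obj.of} :
    c ∈ relation (f ≫ g) a ↔ ∃ b ∈ relation f a, c ∈ relation g b :=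
  mem_finsetUnion_finsetMap (relation g) (relation f a) c

theorem mem_kleisliToStone_map (f : A ⟶ B) (s : Finset A.obj.of) (b : B.obj.of) :
    b ∈ (show Finset B.obj.of from kleisliToStone.map f s) ↔ ∃ a ∈ s, b ∈ relation f a :=
  mem_finsetUnion_finsetMap (relation f) s b

/-- The functor that sends a finite set `A` to the free join-semilattice `P A`, and a Kleisli
morphism to the preimage map of its underlying relation. -/
def freeSemilattice : FiniteKleisli.{u} ⥤ SemilatSupCat.{u}ᵒᵖ where
  obj A := Opposite.op (SemilatSupCat.of (Set A.obj.of))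
  map {A B} f := Quiver.Hom.op (X := SemilatSupCat.of (Set B.obj.of))
    (Y := SemilatSupCat.of (Set A.obj.of)) (preimageHom (relation f))
  map_id A := congrArg Quiver.Hom.op <|
    DFunLike.ext (F := SupBotHom (Set A.obj.of) (Set A.obj.of)) _ _ fun T => Set.ext fun a => by
      change (∃ b ∈ relation (𝟙 A) a, b ∈ T) ↔ a ∈ T
      simp only [mem_relation_id, exists_eq_left]
  map_comp {A B C} f g := congrArg Quiver.Hom.op <|
    DFunLike.ext (F := SupBotHom (Set C.obj.of) (Set A.obj.of)) _ _ fun T => Set.ext fun a => by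
      change (∃ c ∈ relation (f ≫ g) a, c ∈ T) ↔
        ∃ b ∈ relation f a, ∃ c ∈ relation g b, c ∈ T
      simp only [mem_relation_comp]
      grind

theorem meetsHomeo_kleisliToStone_map (f : A ⟶ B) (s : Finset A.obj.of) :
    meetsHomeo B.obj.of (kleisliToStone.map f s) =
      (meetsHomeo A.obj.of s).comp (preimageHom (relation f)) :=
  DFunLike.ext _ _ fun T => by
    refine Bool.eq_iff_iff.2 (meetsHom_eq_true_iff.trans (.trans ?_ meetsHom_eq_true_iff.symm))
    change (∃ b, b ∈ (show Finset B.obj.of from kleisliToStone.map f s) ∧ b ∈ T) ↔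
      ∃ a, a ∈ s ∧ ∃ b ∈ relation f a, b ∈ T
    simp only [mem_kleisliToStone_map]
    grind

/-- `U_{P_f}` as the composite of `JSL(-, 2)` with the finite free join-semilattices. -/
def kleisliToStoneIso : kleisliToStone.{u} ≅ freeSemilattice ⋙ idealSpace :=
  NatIso.ofComponents
    (fun A => CompHausLike.isoOfHomeo
      (X := Profinite.of (DiscretePowerset A.obj.of))
      (Y := Profinite.of (SupBotHom (Set A.obj.of) Bool)) (meetsHomeo A.obj.of))
    (fun f => ConcreteCategory.hom_ext _ _ fun s => meetsHomeo_kleisliToStone_map f s)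

end KleisliMorphisms

section Codensity

/-- A finite set as an object of the Kleisli category. -/
abbrev finiteKleisliOf (α : Type u) [Finite α] : FiniteKleisli.{u} :=
  ⟨Kleisli.mk finitePowersetMonad α, ‹_›⟩

variable {J : SemilatSupCat.{u}ᵒᵖ} {A B : FiniteKleisli.{u}}

/-- A morphism from the free join-semilattice `P A` to `J`, as an arrow of the opposite category. -/
def freeArrow (f : SupBotHom (Set A.obj.of) J.unop) : StructuredArrow J freeSemilattice :=
  StructuredArrow.mk (Y := A) (Quiver.Hom.op (X := SemilatSupCat.of (Set A.obj.of)) (Y := J.unop) f)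

variable (s : Limits.Cone (StructuredArrow.proj J freeSemilattice ⋙ freeSemilattice))

/-- The leg of the cone `s` at `f : P A → J`, as a morphism of join-semilattices. -/
def coneLeg (f : SupBotHom (Set A.obj.of) J.unop) : SupBotHom (Set A.obj.of) s.pt.unop :=
  (s.π.app (freeArrow f)).unop

theorem coneLeg_comp (f : SupBotHom (Set A.obj.of) J.unop) (k : A.obj.of → Finset B.obj.of) :
    coneLeg s (f.comp (preimageHom k)) = (coneLeg s f).comp (preimageHom k) :=
  let k' : freeArrow f ⟶ freeArrow (f.comp (preimageHom k)) :=
    StructuredArrow.homMk (kleisliHom k) rfl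
  congrArg Quiver.Hom.unop (s.w k').symm

/-- The value at `j` of the comparison map of the cone `s`, read off the leg at the morphism from
the free join-semilattice on one generator that picks out `j`. -/
def coneValue (j : J.unop) : s.pt.unop :=
  coneLeg s (A := finiteKleisliOf PUnit) (freeHom fun _ => j) {PUnit.unit}

/- A subset `S` of `A` is a morphism from the free join-semilattice on one generator to `P A`, and
this morphism is induced by a relation, so the legs of the cone are compatible with it. -/
theorem coneLeg_apply (f : SupBotHom (Set A.obj.of) J.unop) (S : Set A.obj.of) :
    coneLeg s f S = coneValue s (f S) := by
  classical
  let k (a : A.obj.of) : Finset PUnit.{u + 1} := if a ∈ S then {PUnit.unit} else ∅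
  have hk : preimageHom k {PUnit.unit} = S := by
    ext a
    by_cases ha : a ∈ S <;> simp [mem_preimageHom, k, ha]
  have hf : f.comp (preimageHom k) = freeHom fun _ => f S := supBotHom_ext_singleton fun a =>
    (congrArg f hk).trans (freeHom_singleton (fun _ => f S) a).symm
  rw [coneValue, ← hf, coneLeg_comp, SupBotHom.comp_apply, hk]

/-- The morphism of join-semilattices induced by the cone `s`. -/
def coneDesc : SupBotHom J.unop s.pt.unop where
  toFun := coneValue s
  map_sup' j j' := by
    let A := finiteKleisliOf (ULift.{u} Bool)
    let f : SupBotHom (Set A.obj.of) J.unop := freeHom fun b => bif b.down then j else j'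
    have hj : f {⟨true⟩} = j := freeHom_singleton _ _
    have hj' : f {⟨false⟩} = j' := freeHom_singleton _ _
    rw [← hj, ← hj', ← map_sup, ← coneLeg_apply, ← coneLeg_apply, ← coneLeg_apply, map_sup]
  map_bot' := by
    let f : SupBotHom (Set (finiteKleisliOf PUnit).obj.of) J.unop := ⊥
    rw [← map_bot f, ← coneLeg_apply, map_bot]

theorem isCodense_freeSemilattice : IsCodense freeSemilattice.{u} := fun J =>
  ⟨{
    lift s := Quiver.Hom.op (X := J.unop) (Y := s.pt.unop) (coneDesc s)
    fac s h := congrArg Quiver.Hom.op <|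
      DFunLike.ext (F := SupBotHom (Set h.right.obj.of) s.pt.unop) _ _ fun S =>
        (coneLeg_apply s h.hom.unop S).symm
    uniq s m hm := congrArg Quiver.Hom.op <|
      DFunLike.ext (F := SupBotHom J.unop s.pt.unop) _ _ fun j =>
        let f : SupBotHom (Set (finiteKleisliOf PUnit).obj.of) J.unop := freeHom fun _ => j
        have hj : f {PUnit.unit} = j := freeHom_singleton _ _
        have hf : SupBotHom.comp m.unop f = coneLeg s f :=
          congrArg Quiver.Hom.unop (hm (freeArrow f))
        (congrArg (DFunLike.coe (F := SupBotHom J.unop s.pt.unop) m.unop) hj).symm.trans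
          (DFunLike.congr_fun hf {PUnit.unit})
  }⟩

end Codensity

end VietorisCodensity

end

theorem mainTheorem10 :
    -- The Vietoris monad is the monad induced by the dual adjunction, so that `V X` is homeomorphic to
    -- `JSL(Stone(X, 2), 2)`: the closed set `C` corresponds to the morphism whose zero set is the ideal
    -- of all clopen sets that `C` misses.
    (∃ e : VietorisCodensity.vietorisMonad.{u} ≅ VietorisCodensity.dualAdjunction.{u}.toMonad,
      ∀ (X : Profinite.{u}) (C : VietorisCodensity.Hyperspace X) (g : C(X, Bool)),
        DFunLike.coe (F := SupBotHom C(X, Bool) Bool) (e.hom.app X C) g = false ↔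
          C ∈ VietorisCodensity.miss (g ⁻¹' {true})) ∧
    -- The functor `U` sends a finite set `X` to the discrete space `2^X`.
    (∀ X : VietorisCodensity.FiniteKleisli.{u},
      ∃ h : VietorisCodensity.kleisliToStone.obj X ≃ₜ (X.obj.of → Bool),
        ∀ (s : Finset X.obj.of) (x : X.obj.of), h s x = true ↔ x ∈ s) ∧
    -- The codensity monad of `U` exists, is pointwise, and is isomorphic to the Vietoris monad.
    ∃ _ : VietorisCodensity.kleisliToStone.{u}.HasPointwiseRightKanExtension
        VietorisCodensity.kleisliToStone.{u},
      Nonempty (VietorisCodensity.vietorisMonad.{u} ≅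
        VietorisCodensity.codensityMonad VietorisCodensity.kleisliToStone.{u}) := by
  open VietorisCodensity in
  have hpointwise := (counitActionIsPointwise dualAdjunction kleisliToStoneIso
    isCodense_freeSemilattice).hasPointwiseRightKanExtension
  have hcodensity := monadIsoCodensityOfIsCodense dualAdjunction kleisliToStoneIso
    isCodense_freeSemilattice
  exact ⟨⟨vietorisIso, fun _ _ _ => hitHom_eq_false_iff⟩,
    fun X => ⟨powersetHomeo X.obj.of, powersetHomeo_apply⟩,
    hpointwise, ⟨vietorisIso ≪≫ hcodensity⟩⟩
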